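/- Conventions. All Hilbert spaces are finite-dimensional; a quantum operation is a completely positive trace preserving linear map. A quantum operation $\mathcal E$ from operators on $\mathcal H$ to operators on $\mathcal K$ is reversible if there is a quantum operation $\mathcal R$ with $\mathcal R(\mathcal E(\rho))=\rho$ for all density operators $\rho$ on $\mathcal H$; it is vanishing if there is a density operator $\rho_0$ on $\mathcal K$ with $\mathcal E(\rho)=\rho_0$ for all density operators $\rho$ on $\mathcal H$. A quantum secret sharing (QSS) scheme with secret space $\mathcal H$ and shares $\mathcal H_1,\dots,\mathcal H_n$ is a reversible quantum operation $W$ from operators on $\mathcal H$ to operators on $\mathcal H_1\otimes\dots\otimes\mathcal H_n$. It is a pure state scheme if it maps pure states to pure states. A set $X\subseteq N=\{1,\dots,n\}$ is qualified (forbidden) if $W_X=\mathrm{Tr}_{N\setminus X}\circ W$ is reversible (vanishing), and intermediate if it is neither. $W$ is a $(k,L,n)$-threshold ramp QSS scheme if $X$ is forbidden iff $|X|\le k-L$ and $X$ is qualified iff $|X|\ge k$. Statement. Let $1\le L\le k$ and $n=2k-L$, and let $\mathbb F$ be a finite field with $q=|\mathbb F|\ge n$. Let $\mathbb C^{\mathbb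 F}$ have the orthonormal basis $\{|s\rangle\}_{s\in\mathbb F}$, let the secret space be $\mathcal H=(\mathbb C^{\mathbb F})^{\otimes L}$ and let every share be $\mathcal H_i=\mathbb C^{\mathbb F}$, $i=1,\dots,n$. For $c=(c_1,\dots,c_k)\in\mathbb F^k$ put $p_c(t)=\sum_{i=1}^k c_i t^{i-1}$. Let $x_1,\dots,x_n\in\mathbb F$ be distinct. (1) Suppose that $L=k$ or that all $x_i$ are nonzero. Define $$V|s_1,\dots,s_L\rangle=q^{-(k-L)/2}\sum_{c\in\mathbb F^k,\ c_j=s_j\ (1\le j\le L)}|p_c(x_1),\dots,p_c(x_n)\rangle .$$ Then $V$ is an isometry, and $W(\rho)=V\rho V^*$ is a pure state $(k,L,n)$-threshold ramp QSS scheme: $X$ is qualified iff $|X|\ge k$, forbidden iff $|X|\le k-L$, and intermediate iff $k-L<|X|<k$. (2) Without the condition that the $x_i$ are nonzero, the same conclusions hold for the map $V$ defined in the same way with the secret in the last $L$ coefficients, that is, with the sum over all $c\in\mathbb F^k$ such that $c_{k-L+j}=s_j$ for $1\le j\le L$. (3) The secret has dimension $q^L$ and each share has dimension $q$. This is optimal: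 every $(k,L,n)$-threshold ramp QSS scheme (pure or mixed, with arbitrary secret space $\mathcal H$ and shares $\mathcal H_i$) satisfies $$\frac1L\log\dim\mathcal H\le\frac1n\sum_{i=1}^n\log\dim\mathcal H_i,$$ and the schemes in (1) and (2) attain equality. -/

import Mathlib

/-!
Every finite-dimensional Hilbert space is `ℂ^ι` for a finite set `ι` indexing an orthonormal basis,
operators on it are matrices, and a tensor product of such spaces is indexed by the product of the
index sets.
-/

noncomputable section

open scoped Matrix ComplexOrder

namespace RampQSS

/-- The dimension of the Hilbert space with an orthonormal basis indexed by `ι`. -/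
def hilbertDim (ι : Type*) [Fintype ι] : ℕ :=
  Module.finrank ℂ (EuclideanSpace ℂ ι)

/-- The density operators: positive semidefinite operators of trace one. -/
def densityOperators (ι : Type*) [Fintype ι] : Set (Matrix ι ι ℂ) :=
  {ρ | ρ.PosSemidef ∧ ρ.trace = 1}

/-- The pure states `|v⟩⟨v|`, where `v` is a unit vector. -/
def pureStates (ι : Type*) [Fintype ι] : Set (Matrix ι ι ℂ) :=
  {ρ | ∃ v : ι → ℂ, star v ⬝ᵥ v = 1 ∧ ρ = Matrix.vecMulVec v (star v)}

section Operations

variable {ι κ : Type*} [Fintype ι] [Fintype κ]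

/-- The map `id ⊗ Φ` on `ℂ^m ⊗ ℂ^ι`: apply `Φ` to each of the `m × m` blocks. -/
def ampliation (m : ℕ) (Φ : Matrix ι ι ℂ →ₗ[ℂ] Matrix κ κ ℂ)
    (M : Matrix (Fin m × ι) (Fin m × ι) ℂ) : Matrix (Fin m × κ) (Fin m × κ) ℂ :=
  Matrix.of fun p r => Φ (Matrix.of fun i j => M (p.1, i) (r.1, j)) p.2 r.2

/-- Quantum operations: completely positive and trace preserving maps. -/
structure IsQuantumOperation (Φ : Matrix ι ι ℂ →ₗ[ℂ] Matrix κ κ ℂ) : Prop where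
  completelyPositive : ∀ (m : ℕ) (M : Matrix (Fin m × ι) (Fin m × ι) ℂ),
    M.PosSemidef → (ampliation m Φ M).PosSemidef
  tracePreserving : ∀ A : Matrix ι ι ℂ, (Φ A).trace = A.trace

/-- `Φ` is reversible with respect to `S`: some quantum operation undoes it on `S`. -/
def IsReversible (Φ : Matrix ι ι ℂ →ₗ[ℂ] Matrix κ κ ℂ) (S : Set (Matrix ι ι ℂ)) : Prop :=
  ∃ R : Matrix κ κ ℂ →ₗ[ℂ] Matrix ι ι ℂ, IsQuantumOperation R ∧ ∀ ρ ∈ S, R (Φ ρ) = ρ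

/-- `Φ` is vanishing with respect to `S`: it sends all of `S` to one density operator. -/
def IsVanishing (Φ : Matrix ι ι ℂ →ₗ[ℂ] Matrix κ κ ℂ) (S : Set (Matrix ι ι ℂ)) : Prop :=
  ∃ ρ₀ ∈ densityOperators κ, ∀ ρ ∈ S, Φ ρ = ρ₀

/-- The map `ρ ↦ V ρ V*`. -/
def conjugation (V : Matrix κ ι ℂ) : Matrix ι ι ℂ →ₗ[ℂ] Matrix κ κ ℂ where
  toFun ρ := V * ρ * Vᴴ
  map_add' ρ τ := by rw [Matrix.mul_add, Matrix.add_mul]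
  map_smul' a ρ := by simp

end Operations

section Shares

variable {N : Type*} [Fintype N] [DecidableEq N] {σ : Type*} [Fintype σ]
  {κ : N → Type*} [∀ i, Fintype (κ i)]

/-- The partial trace over the complement of `X`, from operators on `⨂ i, ℂ^(κ i)` to operators
on `⨂ i ∈ X, ℂ^(κ i)`. -/
def partialTrace (X : Finset N) :
    Matrix (∀ i, κ i) (∀ i, κ i) ℂ →ₗ[ℂ]
      Matrix (∀ i : {i // i ∈ X}, κ i) (∀ i : {i // i ∈ X}, κ i) ℂ where
  toFun ρ := Matrix.of fun a b => ∑ z : (∀ i : {i // i ∉ X}, κ i),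
    ρ ((Equiv.piEquivPiSubtypeProd (· ∈ X) κ).symm (a, z))
      ((Equiv.piEquivPiSubtypeProd (· ∈ X) κ).symm (b, z))
  map_add' ρ τ := by ext a b; simp [Finset.sum_add_distrib]
  map_smul' c ρ := by ext a b; simp [Finset.mul_sum]

/-- A QSS scheme with secret space `ℂ^σ` and shares `ℂ^(κ i)`, `i ∈ N`. -/
def IsQSSScheme (W : Matrix σ σ ℂ →ₗ[ℂ] Matrix (∀ i, κ i) (∀ i, κ i) ℂ) : Prop :=
  IsQuantumOperation W ∧ IsReversible W (densityOperators σ)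

/-- A pure state scheme: a QSS scheme that sends pure states to pure states. -/
def IsPureStateScheme (W : Matrix σ σ ℂ →ₗ[ℂ] Matrix (∀ i, κ i) (∀ i, κ i) ℂ) : Prop :=
  IsQSSScheme W ∧ ∀ ρ ∈ pureStates σ, W ρ ∈ pureStates (∀ i, κ i)

/-- The shares in `X` determine the secret state. -/
def IsQualified (W : Matrix σ σ ℂ →ₗ[ℂ] Matrix (∀ i, κ i) (∀ i, κ i) ℂ) (X : Finset N) : Prop :=
  IsReversible (partialTrace X ∘ₗ W) (densityOperators σ)

/-- The shares in `X` carry no information on the secret state. -/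
def IsForbidden (W : Matrix σ σ ℂ →ₗ[ℂ] Matrix (∀ i, κ i) (∀ i, κ i) ℂ) (X : Finset N) : Prop :=
  IsVanishing (partialTrace X ∘ₗ W) (densityOperators σ)

/-- Neither qualified nor forbidden. -/
def IsIntermediate (W : Matrix σ σ ℂ →ₗ[ℂ] Matrix (∀ i, κ i) (∀ i, κ i) ℂ) (X : Finset N) :
    Prop :=
  ¬ IsQualified W X ∧ ¬ IsForbidden W X

/-- A `(k, L, n)`-threshold ramp QSS scheme, where `n = |N|`: the forbidden sets are those of size
at most `k - L` (written without subtraction), the qualified sets those of size at least `k`. -/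
structure IsThresholdRampScheme (k L : ℕ)
    (W : Matrix σ σ ℂ →ₗ[ℂ] Matrix (∀ i, κ i) (∀ i, κ i) ℂ) : Prop where
  isQSSScheme : IsQSSScheme W
  forbidden_iff : ∀ X : Finset N, IsForbidden W X ↔ X.card + L ≤ k
  qualified_iff : ∀ X : Finset N, IsQualified W X ↔ k ≤ X.card

end Shares

section Construction

variable {F : Type*} [Field F] [Fintype F] [DecidableEq F] {k L n : ℕ}

/-- `p_c(t) = c₀ + c₁ t + ⋯ + c_{k-1} t^{k-1}`. -/
def polyEval (c : Fin k → F) (t : F) : F :=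
  ∑ i : Fin k, c i * t ^ (i : ℕ)

/-- The first `L` of the `k` coefficient positions. -/
def firstPositions (h : L ≤ k) : Fin L → Fin k :=
  fun j => ⟨j, by omega⟩

/-- The last `L` of the `k` coefficient positions, in increasing order. -/
def lastPositions (h : L ≤ k) : Fin L → Fin k :=
  fun j => ⟨k - L + j, by omega⟩

/-- The coefficient vectors in `F^k` that carry `s ∈ F^L` in the positions `pos`. -/
def coefficientSet (pos : Fin L → Fin k) (s : Fin L → F) : Finset (Fin k → F) :=
  Finset.univ.filter fun c => ∀ j, c (pos j) = s j

/-- The vector `q^{-(k-L)/2} ∑_c |p_c(x_1), …, p_c(x_n)⟩`, where `c` runs through the coefficient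
vectors that carry `s` in the positions `pos`. -/
def encodedVector (pos : Fin L → Fin k) (x : Fin n → F) (s : Fin L → F) : (Fin n → F) → ℂ :=
  ((1 / Real.sqrt ((Fintype.card F : ℝ) ^ (k - L)) : ℝ) : ℂ) •
    ∑ c ∈ coefficientSet pos s, Pi.single (fun i => polyEval c (x i)) (1 : ℂ)

/-- The linear map `V` with `V |s⟩ = encodedVector pos x s`. -/
def encoder (pos : Fin L → Fin k) (x : Fin n → F) : Matrix (Fin n → F) (Fin L → F) ℂ :=
  Matrix.of fun y s => encodedVector pos x s y

/-- `V` is an isometry from `(ℂ^F)^{⊗L}` to `(ℂ^F)^{⊗n}`, and `ρ ↦ V ρ V*` is a pure state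
`(k, L, n)`-threshold ramp QSS scheme, whose intermediate sets are those `X` with
`k - L < |X| < k`. -/
structure IsPureRampEncoding (k L : ℕ) (V : Matrix (Fin n → F) (Fin L → F) ℂ) : Prop where
  isometry : Vᴴ * V = 1
  pureStateScheme : IsPureStateScheme (κ := fun _ : Fin n => F) (conjugation V)
  thresholdRamp : IsThresholdRampScheme (κ := fun _ : Fin n => F) k L (conjugation V)
  intermediate_iff : ∀ X : Finset (Fin n),
    IsIntermediate (κ := fun _ : Fin n => F) (conjugation V) X ↔ k < X.card + L ∧ X.card < k

end Construction

end RampQSS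

end

/-!
On any `k` shares the encoder is, up to a relabelling of the orthonormal basis, the map that adjoins
to the secret one half of a maximally entangled state whose other half lies in the remaining `k - L`
shares: the values at `k` points determine the polynomial, and so do the secret coefficients
together with the values at `k - L` points. Hence `k` shares recover the secret, while `k - L`
shares always see the maximally mixed state.

Sharpness of the thresholds and optimality both follow from one dimension bound: if `A ⊆ X`, with
`A` forbidden and `X` qualified, then the dimension of the secret is at most that of the shares in
`X \ A`. A factor of dimension `d` satisfies `M ≤ d • Tr M ⊗ 1` in the order of complete
positivity, where `Tr` traces out that factor. For the state `M` of the shares in `X` this partial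
trace is a fixed `ρ₀`, as `A` is forbidden, so recovery gives `ρ ≤ d • Tr ρ • B` with `Tr B = d`,
again in that order, and evaluation in the maximally entangled state turns this into
`(dim σ)² ≤ d²`. Optimality is the average of the bound over the cyclic windows of `L` shares.
-/

noncomputable section

open scoped Matrix Kronecker ComplexOrder

namespace RampQSS

section CompletelyPositive

variable {ι κ μ : Type*}

/-- Complete positivity alone, without trace preservation: the order `Φ ≤ Ψ` on linear maps means
that `Ψ - Φ` is completely positive. -/
def IsCompletelyPositive [Fintype ι] [Fintype κ] (Φ : Matrix ι ι ℂ →ₗ[ℂ] Matrix κ κ ℂ) : Prop :=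
  ∀ (m : ℕ) (M : Matrix (Fin m × ι) (Fin m × ι) ℂ), M.PosSemidef → (ampliation m Φ M).PosSemidef

variable [Fintype ι] [Fintype κ] [Fintype μ]

namespace IsCompletelyPositive

theorem comp {Ψ : Matrix κ κ ℂ →ₗ[ℂ] Matrix μ μ ℂ} {Φ : Matrix ι ι ℂ →ₗ[ℂ] Matrix κ κ ℂ}
    (hΨ : IsCompletelyPositive Ψ) (hΦ : IsCompletelyPositive Φ) : IsCompletelyPositive (Ψ ∘ₗ Φ) :=
  fun m M hM => hΨ m _ (hΦ m M hM)

theorem add {Φ Ψ : Matrix ι ι ℂ →ₗ[ℂ] Matrix κ κ ℂ} (hΦ : IsCompletelyPositive Φ)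
    (hΨ : IsCompletelyPositive Ψ) : IsCompletelyPositive (Φ + Ψ) :=
  fun m M hM => (hΦ m M hM).add (hΨ m M hM)

theorem smul {Φ : Matrix ι ι ℂ →ₗ[ℂ] Matrix κ κ ℂ} (hΦ : IsCompletelyPositive Φ) {a : ℂ}
    (ha : 0 ≤ a) : IsCompletelyPositive (a • Φ) :=
  fun m M hM => (hΦ m M hM).smul ha

theorem sum {T : Type*} {Φ : T → Matrix ι ι ℂ →ₗ[ℂ] Matrix κ κ ℂ} (s : Finset T)
    (hΦ : ∀ t ∈ s, IsCompletelyPositive (Φ t)) : IsCompletelyPositive (∑ t ∈ s, Φ t) := by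
  intro m M hM
  have hsum : ampliation m (∑ t ∈ s, Φ t) M = ∑ t ∈ s, ampliation m (Φ t) M := by
    ext p r
    simp [ampliation, Matrix.sum_apply]
  rw [hsum]
  exact Matrix.posSemidef_sum s fun t ht => hΦ t ht m M hM

/-- The expectation of the Choi operator of `Φ` in the unnormalized maximally entangled state. -/
theorem sum_map_single_apply_nonneg [DecidableEq ι] {Φ : Matrix ι ι ℂ →ₗ[ℂ] Matrix ι ι ℂ}
    (hΦ : IsCompletelyPositive Φ) : 0 ≤ ∑ i, ∑ j, Φ (Matrix.single i j 1) i j := by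
  let f := (Fintype.equivFin ι).symm
  let w : Fin (Fintype.card ι) × ι → ℂ := fun p => if f p.1 = p.2 then 1 else 0
  have hchoi : ampliation _ Φ (Matrix.vecMulVec w (star w)) =
      Matrix.of fun p q => Φ (Matrix.single (f p.1) (f q.1) 1) p.2 q.2 := by
    ext p q
    refine congrFun (congrFun (congrArg Φ ?_) _) _
    ext a b
    simp [w, Matrix.vecMulVec_apply, Matrix.single_apply, ← ite_and, and_comm]
  have h := (hΦ _ _ (Matrix.posSemidef_vecMulVec_self_star w)).dotProduct_mulVec_nonneg w
  rw [hchoi] at h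
  rw [← f.sum_comp]
  simp_rw [← f.sum_comp (fun j => Φ (Matrix.single _ j 1) _ j)]
  simpa [w, dotProduct, Matrix.mulVec, Fintype.sum_prod_type, apply_ite (starRingEnd ℂ)] using h

end IsCompletelyPositive

theorem isCompletelyPositive_conjugation (V : Matrix κ ι ℂ) :
    IsCompletelyPositive (conjugation V) := by
  intro m M hM
  have hamp : ampliation m (conjugation V) M =
      ((1 : Matrix (Fin m) (Fin m) ℂ) ⊗ₖ V) * M * ((1 : Matrix (Fin m) (Fin m) ℂ) ⊗ₖ V)ᴴ := by
    ext p r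
    simp [ampliation, conjugation, Matrix.mul_apply, Fintype.sum_prod_type, Matrix.one_apply,
      apply_ite (starRingEnd ℂ), Finset.sum_ite_irrel]
  rw [hamp]
  exact hM.mul_mul_conjTranspose_same _

theorem isCompletelyPositive_card_smul_sum_sub_conjugation_sum {T : Type*} [Fintype T]
    (A : T → Matrix κ ι ℂ) : IsCompletelyPositive
      ((Fintype.card T : ℂ) • ∑ t, conjugation (A t) - conjugation (∑ t, A t)) := by
  have hsquares : (Fintype.card T : ℂ) • ∑ t, conjugation (A t) - conjugation (∑ t, A t) =
      (2⁻¹ : ℂ) • ∑ t, ∑ u, conjugation (A t - A u) := by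
    ext1 M
    simp only [conjugation, LinearMap.sub_apply, LinearMap.smul_apply, LinearMap.sum_apply,
      LinearMap.coe_mk, AddHom.coe_mk, Matrix.conjTranspose_sub, Matrix.conjTranspose_sum,
      Matrix.sub_mul, Matrix.mul_sub, Matrix.sum_mul, Matrix.mul_sum, Finset.sum_sub_distrib,
      Finset.sum_const, Finset.card_univ, ← Nat.cast_smul_eq_nsmul ℂ, ← Finset.smul_sum]
    rw [Finset.sum_comm (f := fun t u => A u * M * (A t)ᴴ)]
    module
  rw [hsquares]
  exact .smul (.sum _ fun t _ => .sum _ fun u _ => isCompletelyPositive_conjugation _)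
    (by positivity)

end CompletelyPositive

section QuantumOperations

variable {ι κ μ : Type*} [Fintype ι] [Fintype κ] [Fintype μ]

theorem IsQuantumOperation.comp {Ψ : Matrix κ κ ℂ →ₗ[ℂ] Matrix μ μ ℂ}
    {Φ : Matrix ι ι ℂ →ₗ[ℂ] Matrix κ κ ℂ} (hΨ : IsQuantumOperation Ψ)
    (hΦ : IsQuantumOperation Φ) : IsQuantumOperation (Ψ ∘ₗ Φ) where
  completelyPositive m M hM := hΨ.completelyPositive m _ (hΦ.completelyPositive m M hM)
  tracePreserving A := (hΨ.tracePreserving _).trans (hΦ.tracePreserving A)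

theorem IsQuantumOperation.map_mem_densityOperators {Φ : Matrix ι ι ℂ →ₗ[ℂ] Matrix κ κ ℂ}
    (hΦ : IsQuantumOperation Φ) {ρ : Matrix ι ι ℂ} (hρ : ρ ∈ densityOperators ι) :
    Φ ρ ∈ densityOperators κ :=
  ⟨(hΦ.completelyPositive 1 _ (hρ.1.submatrix Prod.snd)).submatrix fun k => (0, k),
    (hΦ.tracePreserving ρ).trans hρ.2⟩

theorem isQuantumOperation_conjugation [DecidableEq ι] {V : Matrix κ ι ℂ} (hV : Vᴴ * V = 1) :
    IsQuantumOperation (conjugation V) where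
  completelyPositive := isCompletelyPositive_conjugation V
  tracePreserving A := by
    rw [conjugation, LinearMap.coe_mk, AddHom.coe_mk, Matrix.mul_assoc, Matrix.trace_mul_comm,
      Matrix.mul_assoc, hV, Matrix.mul_one]

theorem conjugation_mem_pureStates [DecidableEq ι] {V : Matrix κ ι ℂ} (hV : Vᴴ * V = 1)
    {ρ : Matrix ι ι ℂ} (hρ : ρ ∈ pureStates ι) : conjugation V ρ ∈ pureStates κ := by
  obtain ⟨v, hv, rfl⟩ := hρ
  refine ⟨V *ᵥ v, ?_, ?_⟩
  · rw [Matrix.star_mulVec, ← Matrix.dotProduct_mulVec, Matrix.mulVec_mulVec, hV,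
      Matrix.one_mulVec, hv]
  · rw [Matrix.star_mulVec, conjugation, LinearMap.coe_mk, AddHom.coe_mk, Matrix.mul_vecMulVec,
      Matrix.vecMulVec_mul]

end QuantumOperations

section Relabel

variable {ι κ μ : Type*} [Fintype μ]

/-- Renaming the orthonormal basis along `e`. -/
def relabel (e : ι ≃ κ) : Matrix ι ι ℂ →ₗ[ℂ] Matrix κ κ ℂ :=
  (Matrix.reindexLinearEquiv ℂ ℂ e e).toLinearMap

theorem relabel_comp_conjugation (e : ι ≃ κ) (V : Matrix ι μ ℂ) :
    relabel e ∘ₗ conjugation V = conjugation (V.submatrix e.symm id) := rfl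

theorem isQuantumOperation_relabel [Fintype ι] [Fintype κ] (e : ι ≃ κ) :
    IsQuantumOperation (relabel e) where
  completelyPositive _ _ hM := hM.submatrix (Prod.map id e.symm)
  tracePreserving A := e.symm.sum_comp fun i => A i i

end Relabel

section TraceRight

variable {α τ : Type*} [Fintype τ]

/-- The partial trace over the second tensor factor. -/
def traceRight : Matrix (α × τ) (α × τ) ℂ →ₗ[ℂ] Matrix α α ℂ where
  toFun ρ := Matrix.of fun a b => ∑ t, ρ (a, t) (b, t)
  map_add' ρ ω := by ext a b; simp [Finset.sum_add_distrib]
  map_smul' c ρ := by ext a b; simp [Finset.mul_sum]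

theorem isQuantumOperation_traceRight [Fintype α] :
    IsQuantumOperation (traceRight : Matrix (α × τ) (α × τ) ℂ →ₗ[ℂ] Matrix α α ℂ) where
  completelyPositive m M hM := by
    have hsum : ampliation m traceRight M =
        ∑ t, M.submatrix (fun p => (p.1, p.2, t)) fun p => (p.1, p.2, t) := by
      ext p r
      simp [ampliation, traceRight, Matrix.sum_apply]
    rw [hsum]
    exact Matrix.posSemidef_sum _ fun t _ => hM.submatrix _
  tracePreserving A := (Fintype.sum_prod_type fun p => A p p).symm

end TraceRight

section DensityOperators

open scoped MatrixOrder Matrix.Norms.L2Operator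

theorem linearMap_ext_densityOperators {ι E : Type*} [Fintype ι] [AddCommGroup E] [Module ℂ E]
    {f g : Matrix ι ι ℂ →ₗ[ℂ] E} (h : ∀ ρ ∈ densityOperators ι, f ρ = g ρ) : f = g := by
  classical
  refine LinearMap.ext_on (CStarAlgebra.span_nonneg (A := Matrix ι ι ℂ)) fun M hM => ?_
  have hM : M.PosSemidef := Matrix.nonneg_iff_posSemidef.1 hM
  rcases eq_or_ne M.trace 0 with h0 | h0
  · rw [hM.trace_eq_zero_iff.1 h0, map_zero, map_zero]
  · have hnormalized := h (M.trace⁻¹ • M)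
      ⟨hM.smul (inv_nonneg.2 hM.trace_nonneg), by simp [inv_mul_cancel₀ h0]⟩
    rw [map_smul, map_smul] at hnormalized
    exact smul_right_injective E (inv_ne_zero h0) hnormalized

end DensityOperators

section DimensionBound

variable {σ α τ : Type*} [Fintype σ] [Fintype α] [Fintype τ]

theorem sum_conjugation_one_kronecker_single [DecidableEq α] [DecidableEq τ]
    (M : Matrix (α × τ) (α × τ) ℂ) :
    (∑ t, ∑ u, conjugation ((1 : Matrix α α ℂ) ⊗ₖ Matrix.single t u 1)) M =
      traceRight M ⊗ₖ (1 : Matrix τ τ ℂ) := by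
  have hterm (t u : τ) : conjugation ((1 : Matrix α α ℂ) ⊗ₖ Matrix.single t u 1) M =
      (M.submatrix (·, u) (·, u)) ⊗ₖ Matrix.single t t 1 := by
    ext p q
    by_cases hp : t = p.2 <;> simp [hp, conjugation, Matrix.mul_apply, Fintype.sum_prod_type,
      Matrix.one_apply, Matrix.single_apply, ite_and, apply_ite (starRingEnd ℂ)]
  ext p q
  simp [hterm, traceRight, Matrix.sum_apply, Matrix.one_apply, Matrix.single_apply, ite_and]

/-- This is `M ≤ d • traceRight M ⊗ 1` for positive `M`, where `d` is the dimension of the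
second factor. -/
theorem isCompletelyPositive_card_smul_sum_conjugation_sub_id [DecidableEq α] [DecidableEq τ] :
    IsCompletelyPositive ((Fintype.card τ : ℂ) •
      ∑ t, ∑ u, conjugation ((1 : Matrix α α ℂ) ⊗ₖ Matrix.single t u (1 : ℂ)) -
        (LinearMap.id : Matrix (α × τ) (α × τ) ℂ →ₗ[ℂ] Matrix (α × τ) (α × τ) ℂ)) := by
  let S (t u : τ) : Matrix (α × τ) (α × τ) ℂ := 1 ⊗ₖ Matrix.single t u 1
  have hid : conjugation (∑ t, S t t) = LinearMap.id := by
    have hone : ∑ t, S t t = 1 := by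
      ext p q
      by_cases hpq : p.1 = q.1 <;>
        simp [hpq, S, Matrix.sum_apply, Matrix.one_apply, Matrix.single_apply, Prod.ext_iff,
          ite_and]
    ext1 M
    simp [hone, conjugation]
  have hsplit : (Fintype.card τ : ℂ) • ∑ t, ∑ u, conjugation (S t u) - LinearMap.id =
      ((Fintype.card τ : ℂ) • ∑ t, conjugation (S t t) - conjugation (∑ t, S t t)) +
        (Fintype.card τ : ℂ) • ∑ t, ∑ u ∈ Finset.univ.erase t, conjugation (S t u) := by
    have hdiag (t : τ) : ∑ u, conjugation (S t u) =
        conjugation (S t t) + ∑ u ∈ Finset.univ.erase t, conjugation (S t u) :=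
      (Finset.add_sum_erase _ _ (Finset.mem_univ t)).symm
    simp_rw [hdiag, hid, Finset.sum_add_distrib]
    module
  rw [hsplit]
  exact (isCompletelyPositive_card_smul_sum_sub_conjugation_sum _).add <| .smul
    (.sum _ fun t _ => .sum _ fun u _ => isCompletelyPositive_conjugation _) (by positivity)

theorem IsCompletelyPositive.card_sq_le_trace {B : Matrix σ σ ℂ}
    (h : IsCompletelyPositive ((Matrix.traceLinearMap σ ℂ ℂ).smulRight B - .id)) :
    (Fintype.card σ : ℂ) ^ 2 ≤ B.trace := by
  classical
  have htrace (i j : σ) :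
      (Matrix.single i j (1 : ℂ)).trace * B i j = if i = j then B i i else 0 := by
    split_ifs with hij
    · rw [hij, Matrix.trace_single_eq_same, one_mul]
    · rw [Matrix.trace_single_eq_of_ne i j 1 hij, zero_mul]
  have hB : ∑ i, B i i = B.trace := rfl
  simpa [htrace, hB, sq] using h.sum_map_single_apply_nonneg

theorem card_le_card_of_traceRight_comp_eq_of_comp_eq_id
    {Φ : Matrix σ σ ℂ →ₗ[ℂ] Matrix (α × τ) (α × τ) ℂ} (hΦ : IsCompletelyPositive Φ)
    {ρ₀ : Matrix α α ℂ} (hρ₀ : ρ₀.trace = 1)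
    (hΦρ₀ : traceRight ∘ₗ Φ = (Matrix.traceLinearMap σ ℂ ℂ).smulRight ρ₀)
    {R : Matrix (α × τ) (α × τ) ℂ →ₗ[ℂ] Matrix σ σ ℂ} (hR : IsQuantumOperation R)
    (hRΦ : R ∘ₗ Φ = LinearMap.id) : Fintype.card σ ≤ Fintype.card τ := by
  classical
  set d := (Fintype.card τ : ℂ) with hd
  let B := R (ρ₀ ⊗ₖ 1)
  have hB : B.trace = d := by
    rw [hR.tracePreserving, Matrix.trace_kronecker, hρ₀, one_mul, Matrix.trace_one]
  have hcp := (IsCompletelyPositive.comp hR.completelyPositive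
    (isCompletelyPositive_card_smul_sum_conjugation_sub_id (α := α) (τ := τ))).comp hΦ
  have hmap : (R ∘ₗ (d • ∑ t, ∑ u, conjugation ((1 : Matrix α α ℂ) ⊗ₖ Matrix.single t u (1 : ℂ)) -
      .id)) ∘ₗ Φ = (Matrix.traceLinearMap σ ℂ ℂ).smulRight (d • B) - .id := by
    ext1 ρ
    have htrace : traceRight (Φ ρ) = ρ.trace • ρ₀ := LinearMap.congr_fun hΦρ₀ ρ
    have hrec : R (Φ ρ) = ρ := LinearMap.congr_fun hRΦ ρ
    rw [LinearMap.comp_apply, LinearMap.comp_apply, LinearMap.sub_apply, LinearMap.smul_apply,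
      sum_conjugation_one_kronecker_single, htrace, Matrix.smul_kronecker]
    simp [B, hrec, smul_comm d]
  rw [hmap] at hcp
  have hle := hcp.card_sq_le_trace
  rw [Matrix.trace_smul, hB, smul_eq_mul, ← sq, hd] at hle
  have hsq : Fintype.card σ ^ 2 ≤ Fintype.card τ ^ 2 := by exact_mod_cast hle
  exact (Nat.pow_le_pow_iff_left two_ne_zero).1 hsq

end DimensionBound

section PartialTrace

variable {N : Type*} [DecidableEq N] {κ : N → Type*}

/-- The tuples of shares in `X` split into those in `A` and those in `X \ A`. -/
def sharesEquiv {A X : Finset N} (h : A ⊆ X) : (∀ i : {i // i ∈ X}, κ i) ≃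
    (∀ i : {i // i ∈ A}, κ i) × (∀ i : {i // i ∈ X \ A}, κ i) where
  toFun f := (fun i => f ⟨i, h i.2⟩, fun i => f ⟨i, (Finset.mem_sdiff.1 i.2).1⟩)
  invFun p i := if hi : i.1 ∈ A then p.1 ⟨i, hi⟩ else p.2 ⟨i, Finset.mem_sdiff.2 ⟨i.2, hi⟩⟩
  left_inv f := by ext i; simp
  right_inv p := by
    ext i
    · simp
    · simp [(Finset.mem_sdiff.1 i.2).2]

/-- The tuples of shares outside `A` split into those in `X \ A` and those outside `X`. -/
def complementEquiv {A X : Finset N} (h : A ⊆ X) : (∀ i : {i // i ∉ A}, κ i) ≃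
    (∀ i : {i // i ∈ X \ A}, κ i) × (∀ i : {i // i ∉ X}, κ i) where
  toFun f := (fun i => f ⟨i, (Finset.mem_sdiff.1 i.2).2⟩, fun i => f ⟨i, fun hi => i.2 (h hi)⟩)
  invFun p i := if hi : i.1 ∈ X then p.1 ⟨i, Finset.mem_sdiff.2 ⟨hi, i.2⟩⟩ else p.2 ⟨i, hi⟩
  left_inv f := by ext i; by_cases hi : i.1 ∈ X <;> simp [hi]
  right_inv p := by
    ext i
    · simp [(Finset.mem_sdiff.1 i.2).1]
    · simp [i.2]

variable [∀ i, Fintype (κ i)]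

theorem isQuantumOperation_traceRight_comp_relabel_sharesEquiv {A X : Finset N}
    (h : A ⊆ X) : IsQuantumOperation (traceRight ∘ₗ relabel (sharesEquiv (κ := κ) h)) :=
  isQuantumOperation_traceRight.comp (isQuantumOperation_relabel _)

variable [Fintype N]

theorem partialTrace_eq_traceRight_comp_relabel (X : Finset N) :
    partialTrace X = traceRight ∘ₗ relabel (Equiv.piEquivPiSubtypeProd (· ∈ X) κ) := rfl

theorem isQuantumOperation_partialTrace (X : Finset N) :
    IsQuantumOperation (partialTrace (κ := κ) X) :=
  isQuantumOperation_traceRight.comp (isQuantumOperation_relabel _)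

theorem partialTrace_eq_traceRight_comp_relabel_comp_partialTrace {A X : Finset N} (h : A ⊆ X) :
    partialTrace (κ := κ) A = traceRight ∘ₗ relabel (sharesEquiv h) ∘ₗ partialTrace X := by
  have hglue (a : ∀ i : {i // i ∈ A}, κ i) (z : ∀ i : {i // i ∉ A}, κ i) :
      (Equiv.piEquivPiSubtypeProd (· ∈ A) κ).symm (a, z) =
        (Equiv.piEquivPiSubtypeProd (· ∈ X) κ).symm ((sharesEquiv h).symm
          (a, (complementEquiv h z).1), (complementEquiv h z).2) := by
    ext i
    by_cases hA : i ∈ A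
    · simp [Equiv.piEquivPiSubtypeProd, sharesEquiv, hA, h hA]
    · by_cases hX : i ∈ X <;>
        simp [Equiv.piEquivPiSubtypeProd, sharesEquiv, complementEquiv, hA, hX]
  ext1 ρ
  ext a b
  simp only [partialTrace, LinearMap.coe_mk, AddHom.coe_mk, Matrix.of_apply, hglue]
  rw [(complementEquiv h).sum_comp fun p => ρ ((Equiv.piEquivPiSubtypeProd (· ∈ X) κ).symm
    ((sharesEquiv h).symm (a, p.1), p.2)) ((Equiv.piEquivPiSubtypeProd (· ∈ X) κ).symm
    ((sharesEquiv h).symm (b, p.1), p.2)), Fintype.sum_prod_type]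
  rfl

variable {σ : Type*} [Fintype σ] {W : Matrix σ σ ℂ →ₗ[ℂ] Matrix (∀ i, κ i) (∀ i, κ i) ℂ}
  {A X : Finset N}

theorem IsQualified.mono (hA : IsQualified W A) (h : A ⊆ X) : IsQualified W X := by
  obtain ⟨R, hR, hrec⟩ := hA
  refine ⟨R ∘ₗ traceRight ∘ₗ relabel (sharesEquiv h),
    hR.comp (isQuantumOperation_traceRight_comp_relabel_sharesEquiv h), ?_⟩
  rwa [partialTrace_eq_traceRight_comp_relabel_comp_partialTrace h] at hrec

theorem IsForbidden.anti (hX : IsForbidden W X) (h : A ⊆ X) : IsForbidden W A := by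
  obtain ⟨ρ₀, hρ₀, hvan⟩ := hX
  refine ⟨traceRight (relabel (sharesEquiv h) ρ₀),
    (isQuantumOperation_traceRight_comp_relabel_sharesEquiv h).map_mem_densityOperators hρ₀,
    fun ρ hρ => ?_⟩
  rw [← hvan ρ hρ, partialTrace_eq_traceRight_comp_relabel_comp_partialTrace h]
  rfl

theorem IsQualified.isQSSScheme (hX : IsQualified W X) (hW : IsQuantumOperation W) :
    IsQSSScheme W := by
  obtain ⟨R, hR, hrec⟩ := hX
  exact ⟨hW, R ∘ₗ partialTrace X, hR.comp (isQuantumOperation_partialTrace X), hrec⟩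

theorem IsForbidden.card_le_prod_sdiff (hA : IsForbidden W A) (hX : IsQualified W X) (h : A ⊆ X)
    (hW : IsQuantumOperation W) : Fintype.card σ ≤ ∏ i ∈ X \ A, Fintype.card (κ i) := by
  obtain ⟨ρ₀, hρ₀, hvan⟩ := hA
  obtain ⟨R, hR, hrec⟩ := hX
  let Φ := relabel (sharesEquiv h) ∘ₗ partialTrace X ∘ₗ W
  have hΦ : IsQuantumOperation Φ :=
    (isQuantumOperation_relabel _).comp ((isQuantumOperation_partialTrace X).comp hW)
  have hΦρ₀ : traceRight ∘ₗ Φ = (Matrix.traceLinearMap σ ℂ ℂ).smulRight ρ₀ :=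
    linearMap_ext_densityOperators fun ρ hρ => by
      rw [LinearMap.smulRight_apply, Matrix.traceLinearMap_apply, hρ.2, one_smul, ← hvan ρ hρ,
        partialTrace_eq_traceRight_comp_relabel_comp_partialTrace h]
      rfl
  have hRΦ : (R ∘ₗ relabel (sharesEquiv h).symm) ∘ₗ Φ = LinearMap.id :=
    linearMap_ext_densityOperators fun ρ hρ => by
      simpa [Φ, relabel] using hrec ρ hρ
  classical
  rw [← Finset.prod_coe_sort, ← Fintype.card_pi]
  exact card_le_card_of_traceRight_comp_eq_of_comp_eq_id hΦ.completelyPositive hρ₀.2 hΦρ₀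
    (hR.comp (isQuantumOperation_relabel _)) hRΦ

end PartialTrace

theorem card_nsmul_le_nsmul_sum_of_forall_card_eq {N M : Type*} [Fintype N] [AddCommMonoid M]
    [PartialOrder M] [IsOrderedAddMonoid M] {L : ℕ} (hL : L ≤ Fintype.card N) {a : N → M} {c : M}
    (hc : ∀ T : Finset N, T.card = L → c ≤ ∑ i ∈ T, a i) :
    Fintype.card N • c ≤ L • ∑ i, a i := by
  classical
  rcases isEmpty_or_nonempty N with _ | _
  · simp
  let e := (Fintype.equivFin N).symm
  have : NeZero (Fintype.card N) := ⟨Fintype.card_ne_zero⟩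
  have hwindow (j : Fin (Fintype.card N)) : c ≤ ∑ l : Fin L, a (e (Fin.castLE hL l + j)) := by
    have hinj : Function.Injective fun l : Fin L => e (Fin.castLE hL l + j) :=
      e.injective.comp ((add_left_injective j).comp (Fin.castLE_injective hL))
    simpa using hc (Finset.univ.map ⟨_, hinj⟩) (by simp)
  calc Fintype.card N • c
      = ∑ _j : Fin (Fintype.card N), c := by simp
    _ ≤ ∑ j, ∑ l : Fin L, a (e (Fin.castLE hL l + j)) := Finset.sum_le_sum fun j _ => hwindow j
    _ = ∑ l : Fin L, ∑ j, a (e (Fin.castLE hL l + j)) := Finset.sum_comm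
    _ = ∑ _l : Fin L, ∑ i, a i := Finset.sum_congr rfl fun l _ =>
        ((Equiv.addLeft (Fin.castLE hL l)).trans e).sum_comp a
    _ = L • ∑ i, a i := by simp

theorem log_natCast_le_sum_log_of_le_prod {N : Type*} {T : Finset N} {m : ℕ} {d : N → ℕ}
    (h : m ≤ ∏ i ∈ T, d i) : Real.log m ≤ ∑ i ∈ T, Real.log (d i) := by
  rcases m.eq_zero_or_pos with rfl | hm
  · simpa using Finset.sum_nonneg fun i _ => Real.log_natCast_nonneg (d i)
  · have hd : ∀ i ∈ T, (d i : ℝ) ≠ 0 := fun i hi =>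
      Nat.cast_ne_zero.2 (Finset.prod_ne_zero_iff.1 (hm.trans_le h).ne' i hi)
    rw [← Real.log_prod hd]
    exact Real.log_le_log (by exact_mod_cast hm) (by exact_mod_cast h)

theorem hilbertDim_eq_card (ι : Type*) [Fintype ι] : hilbertDim ι = Fintype.card ι :=
  finrank_euclideanSpace

section ThresholdRampSchemes

variable {N : Type*} [Fintype N] [DecidableEq N] {κ : N → Type*} [∀ i, Fintype (κ i)]
  {σ : Type*} [Fintype σ] {W : Matrix σ σ ℂ →ₗ[ℂ] Matrix (∀ i, κ i) (∀ i, κ i) ℂ} {k L : ℕ}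

theorem IsThresholdRampScheme.card_nsmul_log_hilbertDim_le (hW : IsThresholdRampScheme k L W)
    (hLk : L ≤ k) (hk : k ≤ Fintype.card N) :
    Fintype.card N • Real.log (hilbertDim σ) ≤ L • ∑ i, Real.log (hilbertDim (κ i)) := by
  refine card_nsmul_le_nsmul_sum_of_forall_card_eq (hLk.trans hk) fun T hT => ?_
  simp only [hilbertDim_eq_card]
  obtain ⟨X, hTX, hX⟩ := Finset.exists_superset_card_eq (s := T) (hT.trans_le hLk) hk
  have hforbidden : IsForbidden W (X \ T) :=
    (hW.forbidden_iff _).2 (by rw [Finset.card_sdiff_of_subset hTX]; omega)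
  have hle := hforbidden.card_le_prod_sdiff ((hW.qualified_iff X).2 hX.ge) Finset.sdiff_subset
    hW.isQSSScheme.1
  rw [Finset.sdiff_sdiff_eq_self hTX] at hle
  exact log_natCast_le_sum_log_of_le_prod hle

theorem IsThresholdRampScheme.isIntermediate_iff (hW : IsThresholdRampScheme k L W)
    (X : Finset N) : IsIntermediate W X ↔ k < X.card + L ∧ X.card < k := by
  rw [IsIntermediate, hW.qualified_iff, hW.forbidden_iff]
  omega

theorem isThresholdRampScheme_of_card_eq {q : ℕ} (hq : 1 < q) (hκ : ∀ i, Fintype.card (κ i) = q)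
    (hσ : Fintype.card σ = q ^ L) (hL : 1 ≤ L) (hLk : L ≤ k)
    (hk : k ≤ Fintype.card N) (hW : IsQuantumOperation W)
    (hforbidden : ∀ X : Finset N, X.card + L ≤ k → IsForbidden W X)
    (hqualified : ∀ X : Finset N, k ≤ X.card → IsQualified W X) :
    IsThresholdRampScheme k L W := by
  have hgap {A X : Finset N} (hA : IsForbidden W A) (hX : IsQualified W X) (h : A ⊆ X) :
      A.card + L ≤ X.card := by
    have hle := hA.card_le_prod_sdiff hX h hW
    simp only [hκ, hσ, Finset.prod_const, Nat.pow_le_pow_iff_right hq,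
      Finset.card_sdiff_of_subset h] at hle
    omega
  refine ⟨(hqualified Finset.univ hk).isQSSScheme hW, fun X => ⟨fun hX => ?_, hforbidden X⟩,
    fun X => ⟨fun hX => ?_, hqualified X⟩⟩
  · obtain ⟨Y, hXY, hY⟩ := Finset.exists_superset_card_eq (le_max_right k X.card)
      (max_le hk X.card_le_univ)
    have hXL := hgap hX (hqualified Y (by omega)) hXY
    omega
  · by_contra hlt
    obtain ⟨A, hAX, hA⟩ := Finset.exists_subset_card_eq (min_le_right (k - L) X.card)
    have hAL := hgap (hforbidden A (by omega)) hX hAX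
    omega

end ThresholdRampSchemes

section EntangledEncoder

theorem inv_sqrt_natCast_mul_self (n : ℕ) :
    (((Real.sqrt n)⁻¹ : ℝ) : ℂ) * ((Real.sqrt n)⁻¹ : ℝ) = (n : ℂ)⁻¹ := by
  rw [← Complex.ofReal_mul, ← mul_inv, Real.mul_self_sqrt (Nat.cast_nonneg n), Complex.ofReal_inv,
    Complex.ofReal_natCast]

variable {σ α β : Type*} [DecidableEq σ] [Fintype β] [DecidableEq β]

/-- The map `|s⟩ ↦ |β|^{-1/2} ∑ b, |e⁻¹ (s, b)⟩ ⊗ |b⟩`. Under the basis relabelling `e` it adjoins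
to the secret a maximally entangled state of two copies of `ℂ^β`. -/
def entangledEncoder (e : α ≃ σ × β) : Matrix (α × β) σ ℂ :=
  Matrix.of fun p s => if e p.1 = (s, p.2) then (((Real.sqrt (Fintype.card β))⁻¹ : ℝ) : ℂ) else 0

theorem entangledEncoder_isometry [Fintype α] [Nonempty β] (e : α ≃ σ × β) :
    (entangledEncoder e)ᴴ * entangledEncoder e = 1 := by
  have hsum (s s' : σ) (b : β) :
      ∑ a, star (entangledEncoder e (a, b) s) * entangledEncoder e (a, b) s' =
        if s = s' then (Fintype.card β : ℂ)⁻¹ else 0 := by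
    rw [Finset.sum_eq_single_of_mem (e.symm (s, b)) (Finset.mem_univ _) fun a _ ha => by
      simp [entangledEncoder, ← e.eq_symm_apply, ha]]
    simp [entangledEncoder, ← inv_sqrt_natCast_mul_self]
  ext s s'
  simp_rw [Matrix.mul_apply, Fintype.sum_prod_type_right, Matrix.conjTranspose_apply, hsum]
  simp [Matrix.one_apply]

variable [Fintype σ]

theorem conjugation_entangledEncoder_apply (e : α ≃ σ × β) (ρ : Matrix σ σ ℂ) (p p' : α × β) :
    conjugation (entangledEncoder e) ρ p p' =
      if (e p.1).2 = p.2 ∧ (e p'.1).2 = p'.2 then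
        (Fintype.card β : ℂ)⁻¹ * ρ (e p.1).1 (e p'.1).1 else 0 := by
  simp only [conjugation, entangledEncoder, LinearMap.coe_mk, AddHom.coe_mk, Matrix.mul_apply,
    Matrix.conjTranspose_apply, Matrix.of_apply, Prod.ext_iff, ← inv_sqrt_natCast_mul_self]
  by_cases h : (e p.1).2 = p.2 <;> by_cases h' : (e p'.1).2 = p'.2 <;>
    simp [h, h', mul_right_comm, apply_ite (starRingEnd ℂ)]

theorem traceRight_relabel_traceRight_conjugation_entangledEncoder [Nonempty β] (e : α ≃ σ × β)
    (ρ : Matrix σ σ ℂ) :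
    traceRight (relabel e (traceRight (conjugation (entangledEncoder e) ρ))) = ρ := by
  ext s s'
  simp [traceRight, relabel, conjugation_entangledEncoder_apply]

theorem traceRight_relabel_prodComm_conjugation_entangledEncoder [Fintype α] (e : α ≃ σ × β)
    (ρ : Matrix σ σ ℂ) :
    traceRight (relabel (Equiv.prodComm α β) (conjugation (entangledEncoder e) ρ)) =
      ((Fintype.card β : ℂ)⁻¹ * ρ.trace) • 1 := by
  have hsum (b b' : β) : ∑ a, conjugation (entangledEncoder e) ρ (a, b) (a, b') =
      ∑ p : σ × β, if p.2 = b ∧ p.2 = b' then (Fintype.card β : ℂ)⁻¹ * ρ p.1 p.1 else 0 := by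
    simp_rw [conjugation_entangledEncoder_apply, ← e.sum_comp]
  ext b b'
  refine (hsum b b').trans ?_
  simp [Fintype.sum_prod_type, ite_and, Matrix.trace, Matrix.one_apply, ← Finset.mul_sum]

variable {N : Type*} [Fintype N] [DecidableEq N] {κ : N → Type*} [∀ i, Fintype (κ i)]
  {V : Matrix (∀ i, κ i) σ ℂ} {X : Finset N}
  [∀ i, DecidableEq (κ i)] [∀ i, Nonempty (κ i)]

theorem isQualified_of_submatrix_eq_entangledEncoder
    {e : (∀ i : {i // i ∈ X}, κ i) ≃ σ × (∀ i : {i // i ∉ X}, κ i)}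
    (hV : V.submatrix (Equiv.piEquivPiSubtypeProd (· ∈ X) κ).symm id = entangledEncoder e) :
    IsQualified (conjugation V) X := by
  refine ⟨traceRight ∘ₗ relabel e,
    isQuantumOperation_traceRight.comp (isQuantumOperation_relabel e), fun ρ _ => ?_⟩
  rw [partialTrace_eq_traceRight_comp_relabel, LinearMap.comp_assoc, relabel_comp_conjugation, hV]
  exact traceRight_relabel_traceRight_conjugation_entangledEncoder e ρ

theorem isForbidden_of_submatrix_eq_entangledEncoder
    {e : (∀ i : {i // i ∉ X}, κ i) ≃ σ × (∀ i : {i // i ∈ X}, κ i)}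
    (hV : V.submatrix ((Equiv.piEquivPiSubtypeProd (· ∈ X) κ).trans (Equiv.prodComm _ _)).symm id =
      entangledEncoder e) : IsForbidden (conjugation V) X := by
  have hvan (ρ : Matrix σ σ ℂ) : (partialTrace X ∘ₗ conjugation V) ρ =
      ((Fintype.card (∀ i : {i // i ∈ X}, κ i) : ℂ)⁻¹ * ρ.trace) • 1 := by
    rw [← traceRight_relabel_prodComm_conjugation_entangledEncoder e ρ, ← hV]
    rfl
  refine ⟨(Fintype.card (∀ i : {i // i ∈ X}, κ i) : ℂ)⁻¹ • 1,
    ⟨Matrix.PosSemidef.one.smul (by positivity), ?_⟩, fun ρ hρ => ?_⟩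
  · rw [Matrix.trace_smul, Matrix.trace_one, smul_eq_mul,
      inv_mul_cancel₀ (Nat.cast_ne_zero.2 Fintype.card_ne_zero)]
  · rw [hvan, hρ.2, mul_one]

end EntangledEncoder

section PolynomialCodes

variable {F I : Type*} [Field F] [Fintype I] {k L n : ℕ}

theorem polyEval_sub (c c' : Fin k → F) (t : F) :
    polyEval (c - c') t = polyEval c t - polyEval c' t := by
  simp [polyEval, sub_mul]

theorem eq_zero_of_forall_polyEval_eq_zero {y : I → F} (hy : Function.Injective y)
    (hI : Fintype.card I = k) {c : Fin k → F} (hc : ∀ i, polyEval c (y i) = 0) : c = 0 := by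
  let e := (Fintype.equivFinOfCardEq hI).symm
  exact Matrix.eq_zero_of_forall_index_sum_mul_pow_eq_zero (hy.comp e.injective) fun j => hc (e j)

theorem polyEval_eq_pow_mul_polyEval {m j : ℕ} (h : m + j ≤ k) {c : Fin k → F}
    (hc : ∀ i : Fin k, (i : ℕ) < m ∨ m + j ≤ i → c i = 0) (t : F) :
    polyEval c t = t ^ m * polyEval (fun i : Fin j => c ⟨m + i, by omega⟩) t := by
  rw [polyEval, polyEval, Finset.mul_sum]
  refine (Fintype.sum_of_injective (fun i : Fin j => (⟨m + i, by omega⟩ : Fin k)) ?_ _ _ ?_ ?_).symm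
  · intro i i' hii'
    simpa [Fin.ext_iff] using hii'
  · intro i hi
    rw [hc i, zero_mul]
    by_contra! hwindow
    exact hi ⟨⟨i - m, by omega⟩, Fin.ext (by simp; omega)⟩
  · intro i
    ring

theorem eq_zero_of_forall_polyEval_eq_zero_of_window {m j : ℕ} (h : m + j ≤ k) {y : I → F}
    (hy : Function.Injective y) (hI : Fintype.card I = j) (hym : ∀ i, y i ^ m ≠ 0)
    {c : Fin k → F} (hc : ∀ i : Fin k, (i : ℕ) < m ∨ m + j ≤ i → c i = 0)
    (hcy : ∀ i, polyEval c (y i) = 0) : c = 0 := by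
  have hwindow := eq_zero_of_forall_polyEval_eq_zero hy hI fun i =>
    (mul_eq_zero.1 ((polyEval_eq_pow_mul_polyEval h hc _).symm.trans (hcy i))).resolve_left (hym i)
  funext i
  by_cases hi : (i : ℕ) < m ∨ m + j ≤ i
  · exact hc i hi
  · have hi' : (⟨m + (i - m), by omega⟩ : Fin k) = i := Fin.ext (Nat.add_sub_cancel' (by omega))
    exact hi' ▸ congrFun hwindow ⟨i - m, by omega⟩

/-- The secret coefficients together with any `k - L` shares determine the polynomial. -/
def DeterminesPolynomial (pos : Fin L → Fin k) (x : Fin n → F) : Prop :=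
  ∀ Z : Finset (Fin n), Z.card + L = k → ∀ c : Fin k → F,
    (∀ j, c (pos j) = 0) → (∀ i ∈ Z, polyEval c (x i) = 0) → c = 0

theorem determinesPolynomial_firstPositions (hLk : L ≤ k) {x : Fin n → F}
    (hx : Function.Injective x) (hx0 : L < k → ∀ i, x i ≠ 0) :
    DeterminesPolynomial (firstPositions hLk) x := by
  intro Z hZ c hpos hc
  refine eq_zero_of_forall_polyEval_eq_zero_of_window (j := Z.card) (by omega)
    (hx.comp Subtype.val_injective) (Fintype.card_coe Z) (fun i => pow_ne_zero L (hx0 ?_ i))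
    (fun i hi => hpos ⟨i, by omega⟩) fun i => hc i i.2
  have := Finset.card_pos.2 ⟨_, i.2⟩
  omega

theorem determinesPolynomial_lastPositions (hLk : L ≤ k) {x : Fin n → F}
    (hx : Function.Injective x) : DeterminesPolynomial (lastPositions hLk) x := by
  intro Z hZ c hpos hc
  refine eq_zero_of_forall_polyEval_eq_zero_of_window (m := 0) (j := Z.card) (by omega)
    (hx.comp Subtype.val_injective) (Fintype.card_coe Z) (by simp) (fun i hi => ?_)
    fun i => hc i i.2
  convert hpos ⟨i - (k - L), by omega⟩ using 2
  ext
  simp only [lastPositions]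
  omega

theorem bijective_polyEval [Finite F] {y : I → F} (hy : Function.Injective y)
    (hI : Fintype.card I = k) : Function.Bijective fun (c : Fin k → F) i => polyEval c (y i) := by
  refine Function.Injective.bijective_of_nat_card_le (fun c c' hcc' => sub_eq_zero.1 ?_)
    (by simp [Nat.card_fun, hI])
  exact eq_zero_of_forall_polyEval_eq_zero hy hI fun i => by
    rw [polyEval_sub, sub_eq_zero]
    exact congrFun hcc' i

theorem bijective_comp_prod_polyEval [Finite F] {pos : Fin L → Fin k} {y : I → F}
    (hI : Fintype.card I + L = k)
    (h : ∀ c : Fin k → F, (∀ j, c (pos j) = 0) → (∀ i, polyEval c (y i) = 0) → c = 0) :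
    Function.Bijective fun c : Fin k → F => (c ∘ pos, fun i => polyEval c (y i)) := by
  refine Function.Injective.bijective_of_nat_card_le (fun c c' hcc' => ?_)
    (by simp [Nat.card_fun, ← hI, pow_add, mul_comm])
  obtain ⟨hpos, hy⟩ := Prod.ext_iff.1 hcc'
  refine sub_eq_zero.1 (h _ (fun j => sub_eq_zero.2 (congrFun hpos j)) fun i => ?_)
  rw [polyEval_sub, sub_eq_zero]
  exact congrFun hy i

end PolynomialCodes

section Encoder

variable {F : Type*} [Field F] [Fintype F] [DecidableEq F] {k L n : ℕ} {pos : Fin L → Fin k}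
  {x : Fin n → F}

theorem encoder_submatrix_eq_entangledEncoder {α β : Type*} [Fintype β] [DecidableEq β]
    (hLk : L ≤ k) {ψ : (Fin n → F) ≃ α × β} {e₁ : (Fin k → F) ≃ α}
    {e₂ : (Fin k → F) ≃ (Fin L → F) × β} (hpos : ∀ c, (e₂ c).1 = c ∘ pos)
    (hψ : ∀ c, ψ (fun i => polyEval c (x i)) = (e₁ c, (e₂ c).2)) :
    (encoder pos x).submatrix ψ.symm id = entangledEncoder (e₁.symm.trans e₂) := by
  have hβ : Fintype.card β = Fintype.card F ^ (k - L) := by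
    have hcard := Fintype.card_congr e₂
    simp only [Fintype.card_prod, Fintype.card_fun, Fintype.card_fin] at hcard
    refine Nat.eq_of_mul_eq_mul_left (pow_pos (Fintype.card_pos (α := F)) L) ?_
    rw [← hcard, ← pow_add, Nat.add_sub_cancel' hLk]
  have hmem (c : Fin k → F) (s : Fin L → F) : (∀ j, c (pos j) = s j) ↔ (e₂ c).1 = s := by
    simp [hpos, funext_iff]
  have hword (c : Fin k → F) (p : α × β) : ψ.symm p = (fun i => polyEval c (x i)) ↔
      c = e₁.symm p.1 ∧ (e₂ c).2 = p.2 := by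
    rw [ψ.symm_apply_eq, hψ, Prod.ext_iff, e₁.eq_symm_apply, eq_comm, @eq_comm _ p.2]
  have hsum (p : α × β) (s : Fin L → F) : ∑ c ∈ coefficientSet pos s,
      (Pi.single (fun i => polyEval c (x i)) 1 : (Fin n → F) → ℂ) (ψ.symm p) =
        if e₂ (e₁.symm p.1) = (s, p.2) then 1 else 0 := by
    rw [coefficientSet, Finset.sum_filter, Finset.sum_eq_single_of_mem (e₁.symm p.1)
      (Finset.mem_univ _) fun c _ hc => by simp [hword, hc]]
    simp [Pi.single_apply, hmem, hword, Prod.ext_iff, ite_and]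
  ext p s
  simp [encoder, encodedVector, entangledEncoder, Finset.sum_apply, hsum, hβ]

theorem exists_encoder_submatrix_eq_entangledEncoder (hLk : L ≤ k) (hn : n + L = 2 * k)
    (hx : Function.Injective x) (hpos : DeterminesPolynomial pos x) {X : Finset (Fin n)}
    (hX : X.card = k) :
    ∃ e : ({i // i ∈ X} → F) ≃ (Fin L → F) × ({i // i ∉ X} → F),
      (encoder pos x).submatrix (Equiv.piEquivPiSubtypeProd (· ∈ X) fun _ => F).symm id =
        entangledEncoder e := by
  let e₁ := Equiv.ofBijective _ (bijective_polyEval (k := k) (y := fun i : {i // i ∈ X} => x i)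
    (hx.comp Subtype.val_injective) (by simp [hX]))
  have hXc : Xᶜ.card + L = k := by rw [Finset.card_compl, hX, Fintype.card_fin]; omega
  let e₂ := Equiv.ofBijective _ (bijective_comp_prod_polyEval (y := fun i : {i // i ∉ X} => x i)
    (by simpa [Fintype.card_subtype_compl, Finset.card_compl] using hXc)
      fun c hc hcx => hpos Xᶜ hXc c hc fun i hi => hcx ⟨i, by simpa using hi⟩)
  exact ⟨e₁.symm.trans e₂, encoder_submatrix_eq_entangledEncoder hLk (fun _ => rfl) fun _ => rfl⟩

theorem encoder_isometry (hLk : L ≤ k) (hn : n + L = 2 * k) (hx : Function.Injective x)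
    (hpos : DeterminesPolynomial pos x) : (encoder pos x)ᴴ * encoder pos x = 1 := by
  obtain ⟨X, -, hX⟩ := Finset.exists_subset_card_eq (s := (Finset.univ : Finset (Fin n))) (n := k)
    (by rw [Finset.card_univ, Fintype.card_fin]; omega)
  obtain ⟨e, he⟩ := exists_encoder_submatrix_eq_entangledEncoder hLk hn hx hpos hX
  rw [← entangledEncoder_isometry e, ← he, Matrix.conjTranspose_submatrix,
    Matrix.submatrix_mul_equiv, Matrix.submatrix_id_id]

theorem isQualified_encoder (hLk : L ≤ k) (hn : n + L = 2 * k) (hx : Function.Injective x)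
    (hpos : DeterminesPolynomial pos x) {X : Finset (Fin n)} (hX : k ≤ X.card) :
    IsQualified (κ := fun _ => F) (conjugation (encoder pos x)) X := by
  obtain ⟨A, hAX, hA⟩ := Finset.exists_subset_card_eq hX
  obtain ⟨e, he⟩ := exists_encoder_submatrix_eq_entangledEncoder hLk hn hx hpos hA
  have hqualified : IsQualified (κ := fun _ => F) (conjugation (encoder pos x)) A :=
    isQualified_of_submatrix_eq_entangledEncoder (κ := fun _ => F) he
  exact hqualified.mono hAX

theorem isForbidden_encoder (hLk : L ≤ k) (hn : n + L = 2 * k) (hx : Function.Injective x)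
    (hpos : DeterminesPolynomial pos x) {X : Finset (Fin n)} (hX : X.card + L ≤ k) :
    IsForbidden (κ := fun _ => F) (conjugation (encoder pos x)) X := by
  obtain ⟨Y, hXY, hY⟩ := Finset.exists_superset_card_eq (s := X) (n := k - L) (by omega)
    (by rw [Fintype.card_fin]; omega)
  let e₁ := Equiv.ofBijective _ (bijective_polyEval (k := k) (y := fun i : {i // i ∉ Y} => x i)
    (hx.comp Subtype.val_injective) (by simp [Fintype.card_subtype_compl]; omega))
  let e₂ := Equiv.ofBijective _ (bijective_comp_prod_polyEval (y := fun i : {i // i ∈ Y} => x i)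
    (by simp; omega) fun c hc hcx => hpos Y (by omega) c hc fun i hi => hcx ⟨i, hi⟩)
  have hforbidden : IsForbidden (κ := fun _ => F) (conjugation (encoder pos x)) Y :=
    isForbidden_of_submatrix_eq_entangledEncoder (e := e₁.symm.trans e₂)
      (encoder_submatrix_eq_entangledEncoder hLk (fun _ => rfl) fun _ => rfl)
  exact hforbidden.anti hXY

theorem isPureRampEncoding_encoder (hL : 1 ≤ L) (hLk : L ≤ k) (hn : n + L = 2 * k)
    (hx : Function.Injective x) (hpos : DeterminesPolynomial pos x) :
    IsPureRampEncoding k L (encoder pos x) := by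
  have hV := encoder_isometry hLk hn hx hpos
  have hramp : IsThresholdRampScheme (κ := fun _ => F) k L (conjugation (encoder pos x)) :=
    isThresholdRampScheme_of_card_eq (Fintype.one_lt_card (α := F)) (fun _ => rfl) (by simp) hL hLk
      (by rw [Fintype.card_fin]; omega) (isQuantumOperation_conjugation hV)
      (fun _ => isForbidden_encoder hLk hn hx hpos) fun _ => isQualified_encoder hLk hn hx hpos
  exact ⟨hV, ⟨hramp.isQSSScheme, fun _ => conjugation_mem_pureStates hV⟩, hramp,
    hramp.isIntermediate_iff⟩

end Encoder

end RampQSS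

end

theorem mainTheorem7 {F : Type*} [Field F] [Fintype F] [DecidableEq F] (k L n : ℕ)
    (hL : 1 ≤ L) (hLk : L ≤ k) (hn : n + L = 2 * k) (hq : n ≤ Fintype.card F) :
    -- the secret in the first `L` coefficients, evaluation at distinct nonzero points
    (∀ x : Fin n → F, Function.Injective x → (L < k → ∀ i, x i ≠ 0) →
      RampQSS.IsPureRampEncoding k L (RampQSS.encoder (RampQSS.firstPositions hLk) x)) ∧
    -- the secret in the last `L` coefficients, evaluation at arbitrary distinct points
    (∀ x : Fin n → F, Function.Injective x →
      RampQSS.IsPureRampEncoding k L (RampQSS.encoder (RampQSS.lastPositions hLk) x)) ∧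
    -- the dimensions of the secret and of the shares
    RampQSS.hilbertDim (Fin L → F) = Fintype.card F ^ L ∧
    RampQSS.hilbertDim F = Fintype.card F ∧
    -- optimality: a bound on all such schemes, which these dimensions attain
    (∀ (σ : Type*) (κ : Fin n → Type*) [Fintype σ] [∀ i, Fintype (κ i)]
      (W : Matrix σ σ ℂ →ₗ[ℂ] Matrix (∀ i, κ i) (∀ i, κ i) ℂ),
      RampQSS.IsThresholdRampScheme k L W →
        1 / (L : ℝ) * Real.log (RampQSS.hilbertDim σ) ≤
          1 / (n : ℝ) * ∑ i, Real.log (RampQSS.hilbertDim (κ i))) ∧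
    1 / (L : ℝ) * Real.log (RampQSS.hilbertDim (Fin L → F)) =
      1 / (n : ℝ) * ∑ _i : Fin n, Real.log (RampQSS.hilbertDim F) := by
  have hn0 : (n : ℝ) ≠ 0 := Nat.cast_ne_zero.2 (by omega)
  have hL0 : (L : ℝ) ≠ 0 := Nat.cast_ne_zero.2 (by omega)
  have hdim : RampQSS.hilbertDim (Fin L → F) = Fintype.card F ^ L := by
    simp [RampQSS.hilbertDim_eq_card]
  refine ⟨fun x hx hx0 => RampQSS.isPureRampEncoding_encoder hL hLk hn hx
      (RampQSS.determinesPolynomial_firstPositions hLk hx hx0),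
    fun x hx => RampQSS.isPureRampEncoding_encoder hL hLk hn hx
      (RampQSS.determinesPolynomial_lastPositions hLk hx),
    hdim, RampQSS.hilbertDim_eq_card F, fun σ κ _ _ W hW => ?_, ?_⟩
  · have hle := hW.card_nsmul_log_hilbertDim_le hLk (by rw [Fintype.card_fin]; omega)
    rw [Fintype.card_fin, nsmul_eq_mul, nsmul_eq_mul] at hle
    rw [one_div_mul_eq_div, one_div_mul_eq_div, div_le_div_iff₀ (by positivity) (by positivity)]
    linarith
  · simp [hdim, RampQSS.hilbertDim_eq_card F, hn0, hL0]
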